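/- Let $(\mathbb X,d_{\mathbb X})$ and $(\mathbb U,d_{\mathbb U})$ be nonempty complete separable metric spaces with their Borel $\sigma$-algebras. An MDP $(\mathbb X,\mathbb U,\mathcal T,c)$ consists of a transition kernel $\mathcal T(dy\mid x,u)$ and a cost $c:\mathbb X\times\mathbb U\to\mathbb R$. A policy $\gamma$ chooses each action $U_t$ at random, measurably in the history $(X_0,U_0,\dots,X_{t-1},U_{t-1},X_t)$; a measurable $\gamma:\mathbb X\to\mathbb U$ is identified with the policy $U_t=\gamma(X_t)$. Write $$J_\beta(c,\mathcal T,\gamma)(x)=\mathbb E^{\mathcal T,\gamma}_x\Big[\sum_{t\ge 0}\beta^t c(X_t,U_t)\Big],\qquad J_\infty(c,\mathcal T,\gamma)(x)=\limsup_{N\to\infty}\frac1N\,\mathbb E^{\mathcal T,\gamma}_x\Big[\sum_{t=0}^{N-1}c(X_t,U_t)\Big],$$ and let $J^*_\beta(c,\mathcal T)(x)$, $J^*_\infty(c,\mathcal T)(x)$ be the infima of these over all policies. For bounded measurable $f$ put $$d_f(\mathcal T,\mathcal S)=\sup_{x,u}\Big|\int f\,d\mathcal T(\cdot\mid x,u)-\int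 f\,d\mathcal S(\cdot\mid x,u)\Big|,\qquad d_{\mathcal W_1}(\mathcal T,\mathcal S)=\sup_{\|f\|_{\rm Lip}\le 1}d_f(\mathcal T,\mathcal S).$$ A triplet $(g,h,\gamma)$, with $g\in\mathbb R$, $h$ bounded and continuous on $\mathbb X$, and $\gamma:\mathbb X\to\mathbb U$ measurable, is called a vanishing-discount canonical triplet of $(\mathbb X,\mathbb U,\mathcal T,c)$ if for all $x\in\mathbb X$ $$g+h(x)=\inf_{u\in\mathbb U}\Big\{c(x,u)+\int h\,d\mathcal T(\cdot\mid x,u)\Big\}=c(x,\gamma(x))+\int h\,d\mathcal T(\cdot\mid x,\gamma(x)),$$ and there are a state $z$ and a sequence $\beta(n)\in(0,1)$ increasing to $1$ such that for all $x$, $(1-\beta(n))J^*_{\beta(n)}(c,\mathcal T)(x)\to g$ and $J^*_{\beta(n)}(c,\mathcal T)(x)-J^*_{\beta(n)}(c,\mathcal T)(z)\to h(x)$. **Theorem.** Let $L>0$ and let $(\mathbb X,\mathbb U,\mathcal T,c)$ (reference) and $(\mathbb X,\mathbb U,\mathcal S,\hat c)$ (approximation) be two MDPs. Assume that $\mathbb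 X$ and $\mathbb U$ are compact, that $c$ and $\hat c$ are nonnegative, bounded and continuous on $\mathbb X\times\mathbb U$, that $\mathcal T$ and $\mathcal S$ are weakly continuous in $(x,u)$, and that for each of the two MDPs there is $\beta^*\in(0,1)$ such that its optimal discounted value function $J^*_\beta$ is $L$-Lipschitz for all $\beta\in[\beta^*,1)$. Then both MDPs have vanishing-discount canonical triplets. Let $(g^*_{\hat c,\mathcal S},h^*_{\hat c,\mathcal S},\gamma^*_{\hat c,\mathcal S})$ be any such triplet of $(\mathbb X,\mathbb U,\mathcal S,\hat c)$, and assume that for each $x\in\mathbb X$ there is a sequence $\beta_n(x)\in(0,1)$ increasing to $1$ with $(1-\beta_n(x))\,J_{\beta_n(x)}(c,\mathcal T,\gamma^*_{\hat c,\mathcal S})(x)\to J_\infty(c,\mathcal T,\gamma^*_{\hat c,\mathcal S})(x)$. Then $$\big\|J_\infty(c,\mathcal T,\gamma^*_{\hat c,\mathcal S})-J^*_\infty(c,\mathcal T)\big\|_\infty\le 2\|c-\hat c\|_\infty+2L\,d_{\mathcal W_1}(\mathcal T,\mathcal S).$$ If in addition there is $\widetilde L>0$ such that $\mathcal W_1(\mathcal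 K(\cdot\mid x,u),\mathcal K(\cdot\mid y,u'))\le\widetilde L\,(d_{\mathbb X}(x,y)+d_{\mathbb U}(u,u'))$ for all $x,y\in\mathbb X$, $u,u'\in\mathbb U$ and both $\mathcal K\in\{\mathcal T,\mathcal S\}$, where $\mathcal W_1$ is the Wasserstein-1 distance, then for every vanishing-discount canonical triplet $(g^*_{c,\mathcal T},h^*_{c,\mathcal T},\gamma^*_{c,\mathcal T})$ of $(\mathbb X,\mathbb U,\mathcal T,c)$ $$\big\|J_\infty(c,\mathcal T,\gamma^*_{\hat c,\mathcal S})-J^*_\infty(c,\mathcal T)\big\|_\infty\le 2\|c-\hat c\|_\infty+d_{h^*_{c,\mathcal T}}(\mathcal T,\mathcal S)+d_{h^*_{\hat c,\mathcal S}}(\mathcal T,\mathcal S).$$ -/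

import Mathlib

open MeasureTheory ProbabilityTheory Filter Topology
open scoped BoundedContinuousFunction NNReal

namespace RobustMDP

noncomputable section

/-- Supremum norm of a real function. -/
def supNorm {α : Type*} (f : α → ℝ) : ℝ := ⨆ a, |f a|

section Dynamics

variable {X U : Type*} [MeasurableSpace X] [MeasurableSpace U]

/-- The history available at time `t`: the past pairs `(x₀, u₀), …, (x_{t-1}, u_{t-1})` and the
current state `x_t`. This is `X ^ (t + 1) × U ^ t` with the coordinates listed in time order. -/
abbrev Hist (X U : Type*) (t : ℕ) : Type _ := (Fin t → X × U) × X

/-- An admissible (history dependent, randomized) policy: for every time `t` a measurable map from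
histories to probability measures on the action space. -/
structure Policy (X U : Type*) [MeasurableSpace X] [MeasurableSpace U] where
  act : (t : ℕ) → Kernel (Hist X U t) U
  isMarkov : ∀ t, IsMarkovKernel (act t)

instance (γ : Policy X U) (t : ℕ) : IsMarkovKernel (γ.act t) := γ.isMarkov t

/-- A deterministic stationary policy is a measurable map from states to actions. -/
abbrev StationaryPolicy (X U : Type*) [MeasurableSpace X] [MeasurableSpace U] : Type _ :=
  {f : X → U // Measurable f}

/-- A deterministic stationary policy as an admissible policy. -/
def StationaryPolicy.toPolicy (f : StationaryPolicy X U) : Policy X U where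
  act _ := Kernel.deterministic (fun h => f.1 h.2) (f.2.comp measurable_snd)
  isMarkov _ := inferInstance

/-- The state-action pairs at times `0, …, n` together with a new state form a history at time
`n + 1`. -/
def toHist (n : ℕ) (p : (Finset.Iic n → X × U) × X) : Hist X U (n + 1) :=
  (fun i => p.1 ⟨i.1, Finset.mem_Iic.2 (Nat.lt_succ_iff.1 i.2)⟩, p.2)

lemma measurable_toHist (n : ℕ) : Measurable (toHist (X := X) (U := U) n) := by
  unfold toHist
  fun_prop

/-- The state-action pair at time `n`, out of those at times `0, …, n`. -/
def lastPair (n : ℕ) (w : Finset.Iic n → X × U) : X × U := w ⟨n, Finset.mem_Iic.2 le_rfl⟩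

lemma measurable_lastPair (n : ℕ) : Measurable (lastPair (X := X) (U := U) n) := by
  unfold lastPair
  fun_prop

/-- Conditional law of `(X_{n+1}, U_{n+1})` given `(X_0, U_0), …, (X_n, U_n)`: the state is drawn
from the transition kernel at `(X_n, U_n)`, then the action from the policy at time `n + 1`. -/
def stepKernel (T : Kernel (X × U) X) (γ : Policy X U) (n : ℕ) :
    Kernel (Finset.Iic n → X × U) (X × U) :=
  (T.comap (lastPair n) (measurable_lastPair n)).compProd
    ((γ.act (n + 1)).comap (toHist n) (measurable_toHist n))

instance (T : Kernel (X × U) X) [IsMarkovKernel T] (γ : Policy X U) (n : ℕ) :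
    IsMarkovKernel (stepKernel T γ n) := by
  unfold stepKernel
  infer_instance

/-- Law of `(X_0, U_0)` when the initial state is `x`. -/
def initLaw (γ : Policy X U) (x : X) : Measure (X × U) :=
  (γ.act 0 (Fin.elim0, x)).map (fun u => (x, u))

/-- Law of the controlled process `(X_t, U_t)_{t ≥ 0}` under the transition kernel `T` and the
policy `γ`, started at `x`. -/
def processLaw (T : Kernel (X × U) X) [IsMarkovKernel T] (γ : Policy X U) (x : X) :
    Measure (ℕ → X × U) :=
  Kernel.trajMeasure (X := fun _ => X × U) (initLaw γ x) (stepKernel T γ)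

/-- Expected discounted cost of the policy `γ`. -/
def discCost (β : ℝ) (c : X × U → ℝ) (T : Kernel (X × U) X) [IsMarkovKernel T]
    (γ : Policy X U) (x : X) : ℝ :=
  ∫ ω, ∑' t : ℕ, β ^ t * c (ω t) ∂(processLaw T γ x)

/-- Optimal discounted value function. -/
def discValue (β : ℝ) (c : X × U → ℝ) (T : Kernel (X × U) X) [IsMarkovKernel T] (x : X) : ℝ :=
  ⨅ γ : Policy X U, discCost β c T γ x

/-- Long-run expected average cost of the policy `γ`. -/
def avgCost (c : X × U → ℝ) (T : Kernel (X × U) X) [IsMarkovKernel T]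
    (γ : Policy X U) (x : X) : ℝ :=
  limsup (fun N : ℕ =>
    (1 / (N : ℝ)) * ∫ ω, ∑ t ∈ Finset.range N, c (ω t) ∂(processLaw T γ x)) atTop

/-- Optimal average cost. -/
def avgValue (c : X × U → ℝ) (T : Kernel (X × U) X) [IsMarkovKernel T] (x : X) : ℝ :=
  ⨅ γ : Policy X U, avgCost c T γ x

end Dynamics

section Distances

/-- Uniform discrepancy `d_f(T, S)` of two controlled transition kernels with respect to `f`. -/
def kernelDisc {X U : Type*} [MeasurableSpace X] [MeasurableSpace U] (f : X → ℝ)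
    (T S : Kernel (X × U) X) : ℝ :=
  ⨆ p : X × U, |∫ y, f y ∂(T p) - ∫ y, f y ∂(S p)|

/-- Uniform Wasserstein-1 distance `d_{W₁}(T, S)` of two controlled transition kernels: the supremum
of `d_f(T, S)` over the functions `f` that are Lipschitz with constant `1`. -/
def kernelW1 {X U : Type*} [MetricSpace X] [MeasurableSpace X] [MeasurableSpace U]
    (T S : Kernel (X × U) X) : ℝ :=
  ⨆ f : {f : X → ℝ // LipschitzWith 1 f}, kernelDisc f.1 T S

/-- Wasserstein-1 distance of two probability measures, by couplings. -/
def wasserstein1 {X : Type*} [MetricSpace X] [MeasurableSpace X] (μ ν : Measure X) : ℝ :=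
  ⨅ π : {π : Measure (X × X) // π.map Prod.fst = μ ∧ π.map Prod.snd = ν},
    ∫ p, dist p.1 p.2 ∂π.1

end Distances

section Assumptions

variable {X U : Type*} [MetricSpace X] [MeasurableSpace X] [MetricSpace U] [MeasurableSpace U]

/-- Standing assumption on an MDP: compact action space; nonnegative, bounded, continuous cost;
weakly continuous transition kernel. -/
structure BasicAssumption (c : X × U → ℝ) (T : Kernel (X × U) X) : Prop where
  compact_action : CompactSpace U
  cost_nonneg : ∀ p, 0 ≤ c p
  cost_bounded : ∃ M : ℝ, ∀ p, c p ≤ M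
  cost_continuous : Continuous c
  weakly_continuous : ∀ v : X →ᵇ ℝ, Continuous fun p => ∫ y, v y ∂(T p)

/-- For all discount factors in some `[β*, 1)` with `β* ∈ (0, 1)` the optimal discounted value
function is Lipschitz with constant `L`. -/
def LipschitzNearOne (c : X × U → ℝ) (T : Kernel (X × U) X) [IsMarkovKernel T] (L : ℝ) : Prop :=
  ∃ βs : ℝ, 0 < βs ∧ βs < 1 ∧ ∀ β : ℝ, βs ≤ β → β < 1 →
    ∀ x y : X, |discValue β c T x - discValue β c T y| ≤ L * dist x y

/-- Joint Lipschitz continuity of the kernel in state and action for the Wasserstein-1 distance. -/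
def JointlyW1Lipschitz (T : Kernel (X × U) X) (L : ℝ) : Prop :=
  ∀ (x y : X) (u u' : U), wasserstein1 (T (x, u)) (T (y, u')) ≤ L * (dist x y + dist u u')

/-- A sequence of discount factors in `(0, 1)` that increases to `1`. -/
def IncreasesToOne (β : ℕ → ℝ) : Prop :=
  (∀ n, 0 < β n ∧ β n < 1) ∧ StrictMono β ∧ Tendsto β atTop (𝓝 1)

/-- `(g, h, γ)` is a canonical triplet: `g + h` satisfies the average cost optimality equation and
the deterministic stationary policy `γ` attains the infimum in it. -/
structure IsCanonicalTriplet (c : X × U → ℝ) (T : Kernel (X × U) X)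
    (g : ℝ) (h : X →ᵇ ℝ) (γ : StationaryPolicy X U) : Prop where
  acoe : ∀ x, g + h x = ⨅ u : U, (c (x, u) + ∫ y, h y ∂(T (x, u)))
  attained : ∀ x, g + h x = c (x, γ.1 x) + ∫ y, h y ∂(T (x, γ.1 x))

/-- A canonical triplet that arises in the vanishing discount limit: along some sequence of discount
factors increasing to `1`, the normalized optimal discounted values converge to `g`, and the
optimal discounted values relative to some state `z` converge to `h`. -/
structure IsVanishingDiscountTriplet (c : X × U → ℝ) (T : Kernel (X × U) X) [IsMarkovKernel T]
    (g : ℝ) (h : X →ᵇ ℝ) (γ : StationaryPolicy X U) : Prop where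
  canonical : IsCanonicalTriplet c T g h γ
  limit : ∃ (z : X) (β : ℕ → ℝ), IncreasesToOne β ∧ ∀ x : X,
    Tendsto (fun n => (1 - β n) * discValue (β n) c T x) atTop (𝓝 g) ∧
    Tendsto (fun n => discValue (β n) c T x - discValue (β n) c T z) atTop (𝓝 (h x))

/-- Vanishing discount condition for a fixed policy: at each initial state `x`, along some sequence
of discount factors increasing to `1` (which may depend on `x`), the normalized discounted cost of
the policy tends to its average cost. -/
def VanishingDiscountCondition (c : X × U → ℝ) (T : Kernel (X × U) X) [IsMarkovKernel T]
    (γ : Policy X U) : Prop :=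
  ∀ x : X, ∃ β : ℕ → ℝ, IncreasesToOne β ∧
    Tendsto (fun n => (1 - β n) * discCost (β n) c T γ x) atTop (𝓝 (avgCost c T γ x))

end Assumptions

end

end RobustMDP

/-! The engine is a verification argument. If `g + h ≤ c + ∫ h dT` at every state-action pair, then
integrating along the process and telescoping gives `g ≤ avgCost` for every policy, because the
boundary terms of a bounded `h` vanish after division by `N`. The reverse inequality on the graph of
a stationary policy bounds the average cost of that policy by `g` (`le_avgCost`, `avgCost_le`). A
canonical triplet therefore has `g` equal to the optimal average cost.

For robustness, the triplet of one model is inserted into the other. Along `γS` the optimality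
equation of the approximation holds for `(c, T)` up to `‖c - c'‖ + d_{hS}`, so the cost of `γS`
under `(c, T)` is at most `gS` plus this error. Symmetrically, `gS` is at most the cost of `γT`
under `(c', S)`, hence at most `gT + ‖c - c'‖ + d_{hT}`. Adding the two gives the sharper bound
(`supNorm_avgCost_sub_avgValue_le`). Relative value functions are pointwise limits of differences of
`L`-Lipschitz functions, so each `d_h` is at most `L` times the uniform Wasserstein distance, which
gives the first bound.

Triplets exist by the vanishing discount method: solve the Bellman equation by contraction, extract
a uniform limit of the relative values by Arzelà–Ascoli, and choose a measurable minimizer in the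
limit equation. -/

namespace RobustMDP

/-! ### Marginals of the controlled process. -/

section Trajectory

variable {X U : Type*} [MeasurableSpace X] [MeasurableSpace U]

instance (γ : Policy X U) (x : X) : IsProbabilityMeasure (initLaw γ x) := by
  unfold initLaw
  exact Measure.isProbabilityMeasure_map (by fun_prop)

instance (T : Kernel (X × U) X) [IsMarkovKernel T] (γ : Policy X U) (x : X) :
    IsProbabilityMeasure (processLaw T γ x) := by
  unfold processLaw
  infer_instance

/-- The pair at time `0` has law `initLaw`. -/
lemma processLaw_map_zero (T : Kernel (X × U) X) [IsMarkovKernel T] (γ : Policy X U) (x : X) :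
    (processLaw T γ x).map (fun ω => ω 0) = initLaw γ x := by
  -- `trajMeasure` starts from functions on the one-point index set `Iic 0`, so evaluation at `0` is
  -- factored through it and `piUnique` cancels.
  have h : (fun ω : ℕ → X × U => ω 0) =
      (MeasurableEquiv.piUnique (fun _ : Finset.Iic 0 => X × U)) ∘
        Preorder.frestrictLe (π := fun _ => X × U) 0 := rfl
  rw [h, ← Measure.map_map (by fun_prop) (by fun_prop), processLaw, Kernel.trajMeasure,
    Measure.map_comp _ _ (by fun_prop), Kernel.traj_map_frestrictLe, Kernel.partialTraj_self,
    Measure.id_comp, Measure.map_map (by fun_prop) (by fun_prop)]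
  convert Measure.map_id
  ext1 p
  exact (MeasurableEquiv.piUnique (fun _ : Finset.Iic 0 => X × U)).apply_symm_apply p

/-- The pair at time `n + 1` is drawn from `stepKernel` applied to the pairs up to time `n`. -/
lemma processLaw_map_succ (T : Kernel (X × U) X) [IsMarkovKernel T] (γ : Policy X U) (x : X)
    (n : ℕ) :
    (processLaw T γ x).map (fun ω => ω (n + 1)) =
      stepKernel T γ n ∘ₘ
        (processLaw T γ x).map (Preorder.frestrictLe (π := fun _ => X × U) n) := by
  have h := Kernel.map_frestrictLe_trajMeasure_compProd_eq_map_trajMeasure (X := fun _ => X × U)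
    (μ₀ := initLaw γ x) (κ := stepKernel T γ) (a := n)
  have h2 := congrArg Measure.snd h
  rw [Measure.snd_compProd, Measure.snd, Measure.map_map (by fun_prop) (by fun_prop)] at h2
  exact h2.symm

/-- Taking the first marginal of `stepKernel` discards the policy, and what remains depends on the
last pair only. This is why history dependent policies need no separate treatment. -/
lemma processLaw_map_state_succ (T : Kernel (X × U) X) [IsMarkovKernel T] (γ : Policy X U) (x : X)
    (n : ℕ) :
    (processLaw T γ x).map (fun ω => (ω (n + 1)).1) =
      T ∘ₘ (processLaw T γ x).map (fun ω => ω n) := by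
  have h1 : (processLaw T γ x).map (fun ω => (ω (n + 1)).1) =
      ((processLaw T γ x).map (fun ω => ω (n + 1))).map Prod.fst := by
    rw [Measure.map_map (by fun_prop) (by fun_prop)]; rfl
  have h2 : (processLaw T γ x).map (fun ω => ω n) =
      ((processLaw T γ x).map (Preorder.frestrictLe (π := fun _ => X × U) n)).map
        (lastPair n) := by
    rw [Measure.map_map (measurable_lastPair n) (by fun_prop)]; rfl
  have h3 : (stepKernel T γ n).map Prod.fst = T.comap (lastPair n) (measurable_lastPair n) := by
    rw [← Kernel.fst_eq, stepKernel, Kernel.fst_compProd]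
  rw [h1, h2, processLaw_map_succ, Measure.map_comp _ _ (by fun_prop), h3,
    ← Kernel.comp_deterministic_eq_comap, ← Measure.comp_assoc,
    Measure.deterministic_comp_eq_map]

lemma integral_state_zero (T : Kernel (X × U) X) [IsMarkovKernel T] (γ : Policy X U) (x : X)
    {φ : X → ℝ} (hφ : Measurable φ) :
    ∫ ω, φ (ω 0).1 ∂(processLaw T γ x) = φ x := by
  have h := integral_map (μ := processLaw T γ x) (φ := fun ω => ω 0)
    (f := fun p : X × U => φ p.1) (measurable_pi_apply 0).aemeasurable
    (hφ.comp measurable_fst).aestronglyMeasurable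
  rw [← h, processLaw_map_zero, initLaw, integral_map (by fun_prop)
    (by exact (hφ.comp measurable_fst).aestronglyMeasurable)]
  simp

lemma integral_state_succ (T : Kernel (X × U) X) [IsMarkovKernel T] (γ : Policy X U) (x : X)
    {φ : X → ℝ} (hφ : Measurable φ) {B : ℝ} (hB : ∀ y, |φ y| ≤ B) (n : ℕ) :
    ∫ ω, φ (ω (n + 1)).1 ∂(processLaw T γ x) = ∫ ω, ∫ y, φ y ∂(T (ω n)) ∂(processLaw T γ x) := by
  have h := integral_map (μ := processLaw T γ x) (φ := fun ω => (ω (n + 1)).1)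
    (f := φ) (measurable_pi_apply (n + 1)).fst.aemeasurable hφ.aestronglyMeasurable
  have : IsProbabilityMeasure ((processLaw T γ x).map (fun ω => ω n)) :=
    Measure.isProbabilityMeasure_map (measurable_pi_apply n).aemeasurable
  rw [← h, processLaw_map_state_succ, Measure.comp_eq_comp_const_apply, Kernel.integral_comp,
    Kernel.const_apply, integral_map (measurable_pi_apply n).aemeasurable]
  · exact (hφ.stronglyMeasurable.integral_kernel (κ := T)).aestronglyMeasurable
  · exact Integrable.of_bound hφ.aestronglyMeasurable B (ae_of_all _ hB)

/-- Under a deterministic stationary policy the actions are functions of the states. -/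
lemma ae_action_eq (T : Kernel (X × U) X) [IsMarkovKernel T] [MeasurableEq U]
    (f : StationaryPolicy X U) (x : X) (n : ℕ) :
    ∀ᵐ ω ∂(processLaw T f.toPolicy x), (ω n).2 = f.1 (ω n).1 := by
  have hs : MeasurableSet {p : X × U | p.2 = f.1 p.1} :=
    measurableSet_eq_fun measurable_snd (f.2.comp measurable_fst)
  cases n with
  | zero =>
    have h : ∀ᵐ p ∂((processLaw T f.toPolicy x).map (fun ω => ω 0)), p.2 = f.1 p.1 := by
      rw [processLaw_map_zero, initLaw, ae_map_iff (by fun_prop) hs]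
      change ∀ᵐ u ∂(Kernel.deterministic _ (f.2.comp measurable_snd) _), _
      rw [Kernel.deterministic_apply]
      exact (ae_dirac_iff (hs.preimage measurable_prodMk_left)).2 rfl
    exact (ae_map_iff (by exact (measurable_pi_apply _).aemeasurable) hs).1 h
  | succ n =>
    have h : ∀ᵐ p ∂((processLaw T f.toPolicy x).map (fun ω => ω (n + 1))), p.2 = f.1 p.1 := by
      rw [processLaw_map_succ]
      refine Measure.ae_comp_of_ae_ae hs (ae_of_all _ fun w => ?_)
      rw [stepKernel]
      refine (Kernel.ae_compProd_iff hs).2 (ae_of_all _ fun y => ?_)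
      rw [Kernel.comap_apply]
      change ∀ᵐ u ∂(Kernel.deterministic _ (f.2.comp measurable_snd) _), _
      rw [Kernel.deterministic_apply]
      exact (ae_dirac_iff (hs.preimage measurable_prodMk_left)).2 rfl
    exact (ae_map_iff (by exact (measurable_pi_apply _).aemeasurable) hs).1 h

end Trajectory

/-! ### Telescoping inequalities for real sequences. -/

section Telescoping

lemma sum_add_le_of_forall_le {C v : ℕ → ℝ} {g : ℝ} (h : ∀ t, g + v t ≤ C t + v (t + 1)) (N : ℕ) :
    N * g + v 0 ≤ ∑ t ∈ Finset.range N, C t + v N := by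
  induction N with
  | zero => simp
  | succ N ih =>
    rw [Finset.sum_range_succ]
    push_cast
    linarith [h N]

lemma tendsto_add_div_atTop {v : ℕ → ℝ} {B g : ℝ} (hv : ∀ t, |v t| ≤ B) :
    Tendsto (fun N : ℕ => g + (v 0 - v N) / N) atTop (𝓝 g) := by
  have h : Tendsto (fun N : ℕ => (v 0 - v N) / N) atTop (𝓝 0) := by
    refine squeeze_zero_norm (a := fun N : ℕ => 2 * B / N) (fun N => ?_)
      (tendsto_const_div_atTop_nhds_zero_nat _)
    rw [Real.norm_eq_abs, abs_div, Nat.abs_cast]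
    gcongr
    linarith [abs_sub (v 0) (v N), hv 0, hv N]
  simpa using h.const_add g

lemma abs_average_le {C : ℕ → ℝ} {M : ℝ} (hC : ∀ t, |C t| ≤ M) (N : ℕ) :
    |1 / (N : ℝ) * ∑ t ∈ Finset.range N, C t| ≤ M := by
  have hM : 0 ≤ M := (abs_nonneg _).trans (hC 0)
  -- At `N = 0` the average is `0`, by the convention `1 / 0 = 0`.
  rcases Nat.eq_zero_or_pos N with rfl | hN
  · simpa using hM
  have hN' : (0 : ℝ) < N := by exact_mod_cast hN
  rw [abs_mul, abs_of_pos (by positivity), one_div, inv_mul_le_iff₀ hN']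
  calc _ ≤ ∑ t ∈ Finset.range N, |C t| := Finset.abs_sum_le_sum_abs _ _
    _ ≤ ∑ t ∈ Finset.range N, M := Finset.sum_le_sum fun t _ => hC t
    _ = _ := by simp

/-- Telescoping bounds the average below by `g + (v 0 - v N) / N`, which tends to `g`. The bound on
`C` is there because a `limsup` in `ℝ` is meaningful only for bounded sequences. -/
lemma le_limsup_average {C v : ℕ → ℝ} {g B M : ℝ} (hv : ∀ t, |v t| ≤ B) (hC : ∀ t, |C t| ≤ M)
    (h : ∀ t, g + v t ≤ C t + v (t + 1)) :
    g ≤ limsup (fun N : ℕ => 1 / (N : ℝ) * ∑ t ∈ Finset.range N, C t) atTop := by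
  have ht := tendsto_add_div_atTop (g := g) hv
  rw [← ht.limsup_eq]
  refine limsup_le_limsup ?_ ht.isCoboundedUnder_le
    (isBoundedUnder_of ⟨M, fun N => (abs_le.1 (abs_average_le hC N)).2⟩)
  filter_upwards [eventually_gt_atTop 0] with N hN
  have hN' : (0 : ℝ) < N := by exact_mod_cast hN
  have := sum_add_le_of_forall_le h N
  field_simp
  linarith

lemma limsup_average_le {C v : ℕ → ℝ} {g B M : ℝ} (hv : ∀ t, |v t| ≤ B) (hC : ∀ t, |C t| ≤ M)
    (h : ∀ t, C t + v (t + 1) ≤ g + v t) :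
    limsup (fun N : ℕ => 1 / (N : ℝ) * ∑ t ∈ Finset.range N, C t) atTop ≤ g := by
  have ht := tendsto_add_div_atTop (g := g) hv
  rw [← ht.limsup_eq]
  refine limsup_le_limsup ?_
    (isBoundedUnder_of (r := (· ≥ ·))
      ⟨-M, fun N => (abs_le.1 (abs_average_le hC N)).1⟩).isCoboundedUnder_le
    ht.isBoundedUnder_le
  filter_upwards [eventually_gt_atTop 0] with N hN
  have hN' : (0 : ℝ) < N := by exact_mod_cast hN
  have := sum_add_le_of_forall_le (C := fun t => -C t) (v := fun t => -v t) (g := -g)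
    (fun t => by linarith [h t]) N
  rw [Finset.sum_neg_distrib] at this
  field_simp
  linarith

lemma summable_discounted {C : ℕ → ℝ} {β M : ℝ} (hβ : 0 ≤ β) (hβ1 : β < 1)
    (hC : ∀ t, |C t| ≤ M) : Summable fun t => β ^ t * C t := by
  refine Summable.of_norm_bounded ((summable_geometric_of_lt_one hβ hβ1).mul_right M) fun t => ?_
  rw [Real.norm_eq_abs, abs_mul, abs_of_nonneg (by positivity)]
  gcongr
  exact hC t

lemma le_tsum_discounted {C v : ℕ → ℝ} {β B M : ℝ} (hβ : 0 ≤ β) (hβ1 : β < 1)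
    (hv : ∀ t, |v t| ≤ B) (hC : ∀ t, |C t| ≤ M) (h : ∀ t, v t ≤ C t + β * v (t + 1)) :
    v 0 ≤ ∑' t, β ^ t * C t := by
  -- Iterating the one-step inequality leaves the remainder `β ^ N * v N`, which vanishes in the
  -- limit.
  have h1 : ∀ N : ℕ, v 0 ≤ ∑ t ∈ Finset.range N, β ^ t * C t + β ^ N * v N := by
    intro N
    induction N with
    | zero => simp
    | succ N ih =>
      rw [Finset.sum_range_succ, pow_succ]
      have := mul_le_mul_of_nonneg_left (h N) (pow_nonneg hβ N)
      linarith
  have h2 : Tendsto (fun N : ℕ => β ^ N * v N) atTop (𝓝 0) :=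
    squeeze_zero_norm (a := fun N : ℕ => β ^ N * B)
      (fun N => by
        rw [Real.norm_eq_abs, abs_mul, abs_of_nonneg (by positivity)]
        gcongr
        exact hv N)
      (by simpa using (tendsto_pow_atTop_nhds_zero_of_lt_one hβ hβ1).mul_const B)
  have h3 := ((summable_discounted hβ hβ1 hC).hasSum.tendsto_sum_nat.add h2)
  rw [add_zero] at h3
  exact ge_of_tendsto' h3 h1

lemma tsum_discounted_le {C v : ℕ → ℝ} {β B M : ℝ} (hβ : 0 ≤ β) (hβ1 : β < 1)
    (hv : ∀ t, |v t| ≤ B) (hC : ∀ t, |C t| ≤ M) (h : ∀ t, C t + β * v (t + 1) ≤ v t) :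
    ∑' t, β ^ t * C t ≤ v 0 := by
  have := le_tsum_discounted (C := fun t => -C t) (v := fun t => -v t) hβ hβ1
    (by simpa using hv) (by simpa using hC) (fun t => by linarith [h t])
  simp only [mul_neg, tsum_neg] at this
  linarith

end Telescoping

/-! ### Verification inequalities for average and discounted costs. -/

section Costs

variable {X U : Type*} [MeasurableSpace X] [MeasurableSpace U]

lemma abs_integral_le_of_forall_abs_le {α : Type*} [MeasurableSpace α] (μ : Measure α)
    [IsProbabilityMeasure μ] {f : α → ℝ} {B : ℝ} (hB : ∀ a, |f a| ≤ B) : |∫ a, f a ∂μ| ≤ B := by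
  simpa using norm_integral_le_of_norm_le_const (μ := μ) (f := f) (C := B) (ae_of_all _ hB)

lemma integrable_of_abs_le {α : Type*} [MeasurableSpace α] (μ : Measure α) [IsFiniteMeasure μ]
    {f : α → ℝ} (hf : Measurable f) {B : ℝ} (hB : ∀ a, |f a| ≤ B) : Integrable f μ :=
  Integrable.of_bound hf.aestronglyMeasurable B (ae_of_all _ hB)

lemma integrable_comp_eval {α : Type*} [MeasurableSpace α] (μ : Measure (ℕ → α))
    [IsFiniteMeasure μ] {f : α → ℝ} (hf : Measurable f) {B : ℝ} (hB : ∀ a, |f a| ≤ B) (t : ℕ) :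
    Integrable (fun ω => f (ω t)) μ :=
  integrable_of_abs_le μ (hf.comp (measurable_pi_apply t)) fun ω => hB (ω t)

variable (T : Kernel (X × U) X) {c : X × U → ℝ} {M : ℝ}

lemma measurable_integral_kernel {φ : X → ℝ} (hφ : Measurable φ) :
    Measurable fun p => ∫ y, φ y ∂(T p) :=
  (hφ.stronglyMeasurable.integral_kernel (κ := T)).measurable

variable [IsMarkovKernel T]

lemma avgCost_eq (hc : Measurable c) (hM : ∀ p, |c p| ≤ M) (γ : Policy X U) (x : X) :
    avgCost c T γ x = limsup (fun N : ℕ =>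
      1 / (N : ℝ) * ∑ t ∈ Finset.range N, ∫ ω, c (ω t) ∂(processLaw T γ x)) atTop := by
  unfold avgCost
  congr! 3 with N
  exact integral_finsetSum _ fun t _ =>
    integrable_comp_eval _ hc hM t

lemma discCost_eq {β : ℝ} (hβ : 0 ≤ β) (hβ1 : β < 1) (hc : Measurable c) (hM : ∀ p, |c p| ≤ M)
    (γ : Policy X U) (x : X) :
    discCost β c T γ x = ∑' t, β ^ t * ∫ ω, c (ω t) ∂(processLaw T γ x) := by
  unfold discCost
  have h := integral_tsum_of_summable_integral_norm (μ := processLaw T γ x)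
    (F := fun t ω => β ^ t * c (ω t))
    (fun t => (integrable_comp_eval _ hc hM t).const_mul _) ?_
  · rw [← h]
    simp_rw [integral_const_mul]
  · simp_rw [norm_mul, integral_const_mul, norm_pow, Real.norm_eq_abs, abs_of_nonneg hβ]
    exact summable_discounted hβ hβ1 fun t =>
      abs_integral_le_of_forall_abs_le _ fun ω => by simpa using hM (ω t)

variable {h : X → ℝ} {B : ℝ}

/-- One step of the process, in expectation. -/
lemma integral_add_integral_succ (hc : Measurable c) (hM : ∀ p, |c p| ≤ M) (hh : Measurable h)
    (hB : ∀ y, |h y| ≤ B) (β : ℝ) (γ : Policy X U) (x : X) (t : ℕ) :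
    ∫ ω, c (ω t) ∂(processLaw T γ x) + β * ∫ ω, h (ω (t + 1)).1 ∂(processLaw T γ x) =
      ∫ ω, (c (ω t) + β * ∫ y, h y ∂(T (ω t))) ∂(processLaw T γ x) := by
  have := measurable_integral_kernel T hh
  rw [integral_state_succ T γ x hh hB, integral_add, integral_const_mul]
  · exact integrable_comp_eval _ hc hM t
  · exact (integrable_comp_eval _ this
      (fun _ => abs_integral_le_of_forall_abs_le _ hB) t).const_mul _

lemma integrable_step (hc : Measurable c) (hM : ∀ p, |c p| ≤ M) (hh : Measurable h)
    (hB : ∀ y, |h y| ≤ B) (β : ℝ) (γ : Policy X U) (x : X) (t : ℕ) :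
    Integrable (fun ω => c (ω t) + β * ∫ y, h y ∂(T (ω t))) (processLaw T γ x) := by
  have := measurable_integral_kernel T hh
  exact (integrable_comp_eval _ hc hM t).add
    ((integrable_comp_eval _ this
      (fun _ => abs_integral_le_of_forall_abs_le _ hB) t).const_mul _)

/-- Both parameters are kept so that one lemma serves two criteria: `β = 1` for the average cost, `g
= 0` for the discounted cost. -/
lemma le_integral_step (hc : Measurable c) (hM : ∀ p, |c p| ≤ M) (hh : Measurable h)
    (hB : ∀ y, |h y| ≤ B) {g β : ℝ} (hle : ∀ p, g + h p.1 ≤ c p + β * ∫ y, h y ∂(T p))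
    (γ : Policy X U) (x : X) (t : ℕ) :
    g + ∫ ω, h (ω t).1 ∂(processLaw T γ x) ≤
      ∫ ω, c (ω t) ∂(processLaw T γ x) + β * ∫ ω, h (ω (t + 1)).1 ∂(processLaw T γ x) := by
  have hi : Integrable (fun ω : ℕ → X × U => h (ω t).1) (processLaw T γ x) :=
    integrable_comp_eval _ (hh.comp measurable_fst) (fun p => hB p.1) t
  rw [integral_add_integral_succ T hc hM hh hB]
  calc g + ∫ ω, h (ω t).1 ∂(processLaw T γ x)
      = ∫ ω, (g + h (ω t).1) ∂(processLaw T γ x) := by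
        rw [integral_add (integrable_const _) hi]; simp
    _ ≤ _ := integral_mono ((integrable_const _).add hi) (integrable_step T hc hM hh hB β γ x t)
        fun ω => hle (ω t)

/-- The pointwise inequality is needed only on the graph of `f`, since the process lies on it almost
surely by `ae_action_eq`. -/
lemma integral_step_le [MeasurableEq U] (hc : Measurable c) (hM : ∀ p, |c p| ≤ M)
    (hh : Measurable h) (hB : ∀ y, |h y| ≤ B) {g β : ℝ} (f : StationaryPolicy X U)
    (hle : ∀ y, c (y, f.1 y) + β * ∫ z, h z ∂(T (y, f.1 y)) ≤ g + h y) (x : X) (t : ℕ) :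
    ∫ ω, c (ω t) ∂(processLaw T f.toPolicy x) +
        β * ∫ ω, h (ω (t + 1)).1 ∂(processLaw T f.toPolicy x) ≤
      g + ∫ ω, h (ω t).1 ∂(processLaw T f.toPolicy x) := by
  have hi : Integrable (fun ω : ℕ → X × U => h (ω t).1) (processLaw T f.toPolicy x) :=
    integrable_comp_eval _ (hh.comp measurable_fst) (fun p => hB p.1) t
  rw [integral_add_integral_succ T hc hM hh hB]
  calc _ ≤ ∫ ω, (g + h (ω t).1) ∂(processLaw T f.toPolicy x) := by
        refine integral_mono_ae (integrable_step T hc hM hh hB β _ x t)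
          ((integrable_const _).add hi) ?_
        filter_upwards [ae_action_eq T f x t] with ω hω
        have hω' : ω t = ((ω t).1, f.1 (ω t).1) := Prod.ext rfl hω
        have := hle (ω t).1
        rwa [← hω'] at this
    _ = _ := by rw [integral_add (integrable_const _) hi]; simp

lemma le_avgCost (hc : Measurable c) (hM : ∀ p, |c p| ≤ M) (hh : Measurable h)
    (hB : ∀ y, |h y| ≤ B) {g : ℝ} (hle : ∀ p, g + h p.1 ≤ c p + ∫ y, h y ∂(T p))
    (γ : Policy X U) (x : X) : g ≤ avgCost c T γ x := by
  rw [avgCost_eq T hc hM]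
  refine le_limsup_average (v := fun t => ∫ ω, h (ω t).1 ∂(processLaw T γ x))
    (fun t => abs_integral_le_of_forall_abs_le _ fun ω => hB _)
    (fun t => abs_integral_le_of_forall_abs_le _ fun ω => hM _) fun t => ?_
  simpa using le_integral_step T hc hM hh hB (β := 1) (by simpa using hle) γ x t

lemma avgCost_le [MeasurableEq U] (hc : Measurable c) (hM : ∀ p, |c p| ≤ M) (hh : Measurable h)
    (hB : ∀ y, |h y| ≤ B) {g : ℝ} (f : StationaryPolicy X U)
    (hle : ∀ y, c (y, f.1 y) + ∫ z, h z ∂(T (y, f.1 y)) ≤ g + h y) (x : X) :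
    avgCost c T f.toPolicy x ≤ g := by
  rw [avgCost_eq T hc hM]
  refine limsup_average_le (v := fun t => ∫ ω, h (ω t).1 ∂(processLaw T f.toPolicy x))
    (fun t => abs_integral_le_of_forall_abs_le _ fun ω => hB _)
    (fun t => abs_integral_le_of_forall_abs_le _ fun ω => hM _) fun t => ?_
  simpa using integral_step_le T hc hM hh hB (β := 1) f (by simpa using hle) x t

lemma le_discCost (hc : Measurable c) (hM : ∀ p, |c p| ≤ M) (hh : Measurable h)
    (hB : ∀ y, |h y| ≤ B) {β : ℝ} (hβ : 0 ≤ β) (hβ1 : β < 1)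
    (hle : ∀ p, h p.1 ≤ c p + β * ∫ y, h y ∂(T p)) (γ : Policy X U) (x : X) :
    h x ≤ discCost β c T γ x := by
  rw [discCost_eq T hβ hβ1 hc hM, ← integral_state_zero T γ x hh]
  refine le_tsum_discounted (v := fun t => ∫ ω, h (ω t).1 ∂(processLaw T γ x)) hβ hβ1
    (fun t => abs_integral_le_of_forall_abs_le _ fun ω => hB _)
    (fun t => abs_integral_le_of_forall_abs_le _ fun ω => hM _) fun t => ?_
  simpa using le_integral_step T hc hM hh hB (g := 0) (by simpa using hle) γ x t

lemma discCost_le [MeasurableEq U] (hc : Measurable c) (hM : ∀ p, |c p| ≤ M) (hh : Measurable h)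
    (hB : ∀ y, |h y| ≤ B) {β : ℝ} (hβ : 0 ≤ β) (hβ1 : β < 1) (f : StationaryPolicy X U)
    (hle : ∀ y, c (y, f.1 y) + β * ∫ z, h z ∂(T (y, f.1 y)) ≤ h y) (x : X) :
    discCost β c T f.toPolicy x ≤ h x := by
  rw [discCost_eq T hβ hβ1 hc hM, ← integral_state_zero T f.toPolicy x hh]
  refine tsum_discounted_le (v := fun t => ∫ ω, h (ω t).1 ∂(processLaw T f.toPolicy x)) hβ hβ1
    (fun t => abs_integral_le_of_forall_abs_le _ fun ω => hB _)
    (fun t => abs_integral_le_of_forall_abs_le _ fun ω => hM _) fun t => ?_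
  simpa using integral_step_le T hc hM hh hB (g := 0) f (by simpa using hle) x t

end Costs

/-! ### Minimization over a compact action space and measurable selection. -/

section Minimization

variable {X U : Type*} [TopologicalSpace U] [CompactSpace U]

lemma ciInf_le_of_continuous {f : U → ℝ} (hf : Continuous f) (u : U) : ⨅ u, f u ≤ f u :=
  ciInf_le (isCompact_range hf).bddBelow u

lemma exists_eq_ciInf [Nonempty U] {f : U → ℝ} (hf : Continuous f) : ∃ u, f u = ⨅ u, f u := by
  obtain ⟨u, -, hu⟩ := isCompact_univ.exists_isMinOn Set.univ_nonempty hf.continuousOn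
  exact ⟨u, le_antisymm (le_ciInf fun v => hu (Set.mem_univ v)) (ciInf_le_of_continuous hf u)⟩

/-- Infima of uniformly close functions are close. -/
lemma abs_ciInf_sub_ciInf_le [Nonempty U] {f f' : U → ℝ} (hf : Continuous f) (hf' : Continuous f')
    {ε : ℝ} (h : ∀ u, |f u - f' u| ≤ ε) : |(⨅ u, f u) - ⨅ u, f' u| ≤ ε := by
  obtain ⟨u, hu⟩ := exists_eq_ciInf hf
  obtain ⟨u', hu'⟩ := exists_eq_ciInf hf'
  have h1 := ciInf_le_of_continuous hf u'
  have h2 := ciInf_le_of_continuous hf' u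
  have h3 := abs_le.1 (h u)
  have h4 := abs_le.1 (h u')
  exact abs_le.2 ⟨by linarith, by linarith⟩

lemma continuous_ciInf [TopologicalSpace X] {F : X × U → ℝ} (hF : Continuous F) :
    Continuous fun x => ⨅ u, F (x, u) := by
  simpa [Set.image_univ, sInf_range] using
    isCompact_univ.continuous_sInf (f := fun (x : X) (u : U) => F (x, u)) hF

end Minimization

/-- A continuous function on a product with a compact metric space has a measurable minimizer in
the second variable: parametrize the compact space by the Cantor set and take the least
minimizer. -/
lemma exists_measurable_minimizer {X U : Type*} [TopologicalSpace X] [MeasurableSpace X]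
    [OpensMeasurableSpace X] [MetricSpace U] [CompactSpace U] [Nonempty U] [MeasurableSpace U]
    [BorelSpace U] {F : X × U → ℝ} (hF : Continuous F) :
    ∃ f : X → U, Measurable f ∧ ∀ x, F (x, f x) = ⨅ u, F (x, u) := by
  obtain ⟨φ, hφ, hφs⟩ := exists_nat_bool_continuous_surjective_of_compact U
  have : CompactSpace cantorSet := isCompact_iff_compactSpace.1 isCompact_cantorSet
  set ψ : cantorSet → U := φ ∘ cantorSetHomeomorphNatToBool
  have hψ : Continuous ψ := hφ.comp cantorSetHomeomorphNatToBool.continuous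
  have hψs : ψ.Surjective := hφs.comp cantorSetHomeomorphNatToBool.surjective
  have hm : Continuous fun x => ⨅ u, F (x, u) := continuous_ciInf hF
  have hFx : ∀ x, Continuous fun u => F (x, u) := fun x => by fun_prop
  have hex : ∀ x, ∃ t : cantorSet, F (x, ψ t) = ⨅ u, F (x, u) ∧
      ∀ s : cantorSet, F (x, ψ s) = ⨅ u, F (x, u) → (t : ℝ) ≤ s := by
    intro x
    have hcl : IsClosed {t : cantorSet | F (x, ψ t) = ⨅ u, F (x, u)} :=
      isClosed_eq ((hFx x).comp hψ) continuous_const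
    obtain ⟨t, ht, hmin⟩ := hcl.isCompact.exists_isMinOn (by
      obtain ⟨u, hu⟩ := exists_eq_ciInf (hFx x)
      obtain ⟨t, rfl⟩ := hψs u
      exact ⟨t, hu⟩) continuous_subtype_val.continuousOn
    exact ⟨t, ht, fun s hs => hmin hs⟩
  choose t ht hmin using hex
  -- Since `t x` is the least minimizer, `{x | t x ≤ a}` is the projection of a closed set along the
  -- compact Cantor set, hence closed.
  have hmeas : Measurable fun x => (t x : ℝ) := by
    refine measurable_of_Iic fun a => ?_
    have hcl : IsClosed (Prod.fst '' {p : X × cantorSet | (p.2 : ℝ) ≤ a ∧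
        F (p.1, ψ p.2) = ⨅ u, F (p.1, u)}) := by
      refine isClosedMap_fst_of_compactSpace _ (IsClosed.inter ?_ ?_)
      · exact isClosed_le (continuous_subtype_val.comp continuous_snd) continuous_const
      · exact isClosed_eq (hF.comp (continuous_fst.prodMk (hψ.comp continuous_snd)))
          (hm.comp continuous_fst)
    convert hcl.measurableSet using 1
    ext x
    constructor
    · exact fun hx => ⟨(x, t x), ⟨hx, ht x⟩, rfl⟩
    · rintro ⟨⟨y, s⟩, ⟨hs, hFs⟩, rfl⟩
      exact (hmin y s hFs).trans hs
  exact ⟨fun x => ψ (t x), hψ.measurable.comp hmeas.subtype_mk, ht⟩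

/-! ### Contraction estimates, compactness, and discount sequences. -/

section Auxiliary

variable {X U : Type*} [MetricSpace X] [MeasurableSpace X] [OpensMeasurableSpace X]
  [MeasurableSpace U] {c : X × U → ℝ} {T : Kernel (X × U) X}

lemma abs_integral_sub_integral_le (μ : Measure X) [IsProbabilityMeasure μ]
    (v w : X →ᵇ ℝ) :
    |∫ y, v y ∂μ - ∫ y, w y ∂μ| ≤ dist v w := by
  rw [← integral_sub (v.integrable μ) (w.integrable μ)]
  exact abs_integral_le_of_forall_abs_le μ fun y => by
    simpa [Real.dist_eq] using BoundedContinuousFunction.dist_coe_le_dist (f := v) (g := w) y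

lemma abs_step_sub_step_le [IsMarkovKernel T] {β : ℝ} (hβ : 0 ≤ β)
    (v w : X →ᵇ ℝ) (p : X × U) :
    |(c p + β * ∫ y, v y ∂(T p)) - (c p + β * ∫ y, w y ∂(T p))| ≤ β * dist v w := by
  rw [add_sub_add_left_eq_sub, ← mul_sub, abs_mul, abs_of_nonneg hβ]
  gcongr
  exact abs_integral_sub_integral_le _ v w

end Auxiliary

/-- Arzelà–Ascoli for uniformly Lipschitz functions that vanish at a point. -/
lemma exists_subseq_tendsto_of_lipschitz {X : Type*} [MetricSpace X] [CompactSpace X]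
    {L : ℝ} (z : X) (h : ℕ → X →ᵇ ℝ)
    (hz : ∀ n, h n z = 0) (hL : ∀ n x y, |h n x - h n y| ≤ L * dist x y) :
    ∃ (h' : X →ᵇ ℝ) (k : ℕ → ℕ), StrictMono k ∧ Tendsto (h ∘ k) atTop (𝓝 h') := by
  -- The sign of `L` is not assumed, so `|L|` serves as the Lipschitz constant.
  have hL' : ∀ n x y, |h n x - h n y| ≤ |L| * dist x y := fun n x y =>
    (hL n x y).trans (by gcongr; exact le_abs_self L)
  have hdiam : ∀ x y : X, dist x y ≤ Metric.diam (Set.univ : Set X) := fun x y =>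
    Metric.dist_le_diam_of_mem isCompact_univ.isBounded (Set.mem_univ x) (Set.mem_univ y)
  have hK : IsCompact (closure (Set.range h)) := by
    refine BoundedContinuousFunction.arzela_ascoli
      (Metric.closedBall (0 : ℝ) (|L| * Metric.diam (Set.univ : Set X)))
      (isCompact_closedBall _ _) (Set.range h) ?_ ?_
    · rintro _ x ⟨n, rfl⟩
      rw [mem_closedBall_zero_iff, Real.norm_eq_abs]
      have := hL' n x z
      rw [hz, sub_zero] at this
      exact this.trans (by gcongr; exact hdiam x z)
    · refine (LipschitzWith.uniformEquicontinuous _ (Real.toNNReal |L|) ?_).equicontinuous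
      rintro ⟨_, n, rfl⟩
      refine LipschitzWith.of_dist_le_mul fun x y => ?_
      rw [Real.coe_toNNReal _ (abs_nonneg L)]
      exact hL' n x y
  obtain ⟨h', -, k, hk, hlim⟩ :=
    hK.tendsto_subseq (x := h) fun n => subset_closure (Set.mem_range_self n)
  exact ⟨h', k, hk, hlim⟩

lemma exists_increasesToOne {b : ℝ} (hb : 0 < b) (hb1 : b < 1) :
    ∃ β : ℕ → ℝ, IncreasesToOne β ∧ ∀ n, b ≤ β n := by
  have hpos : ∀ n : ℕ, (1 : ℝ) ≤ n + 1 := fun n => by simp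
  have hle : ∀ n : ℕ, b ≤ 1 - (1 - b) / (n + 1) := fun n => by
    have : (1 - b) / ((n : ℝ) + 1) ≤ 1 - b := div_le_self (by linarith) (hpos n)
    linarith
  refine ⟨fun n => 1 - (1 - b) / (n + 1), ⟨fun n => ⟨hb.trans_le (hle n), ?_⟩, ?_, ?_⟩, hle⟩
  · have : 0 < (1 - b) / ((n : ℝ) + 1) := div_pos (by linarith) (by linarith [hpos n])
    linarith
  · intro m n hmn
    have : (m : ℝ) < n := by exact_mod_cast hmn
    have h1b : 0 < 1 - b := by linarith
    have : (1 - b) / ((n : ℝ) + 1) < (1 - b) / (m + 1) := by gcongr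
    simpa using this
  · have h := (tendsto_one_div_add_atTop_nhds_zero_nat (𝕜 := ℝ)).const_mul (1 - b)
    simpa [div_eq_mul_inv] using h.const_sub 1

lemma IncreasesToOne.comp_strictMono {β : ℕ → ℝ} (hβ : IncreasesToOne β) {k : ℕ → ℕ}
    (hk : StrictMono k) : IncreasesToOne (β ∘ k) :=
  ⟨fun n => hβ.1 (k n), hβ.2.1.comp hk, hβ.2.2.comp hk.tendsto_atTop⟩

/-! ### The discounted Bellman equation and the vanishing discount limit. -/

section Bellman

variable {X U : Type*} [MetricSpace X] [MeasurableSpace X] [MetricSpace U] [MeasurableSpace U]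
  {c : X × U → ℝ} {T : Kernel (X × U) X}

namespace BasicAssumption

lemma continuous_step (hT : BasicAssumption c T) (β : ℝ) (v : X →ᵇ ℝ) :
    Continuous fun p => c p + β * ∫ y, v y ∂(T p) :=
  hT.cost_continuous.add (continuous_const.mul (hT.weakly_continuous v))

lemma continuous_step_right (hT : BasicAssumption c T) (β : ℝ) (v : X →ᵇ ℝ) (x : X) :
    Continuous fun u => c (x, u) + β * ∫ y, v y ∂(T (x, u)) :=
  (hT.continuous_step β v).comp (Continuous.prodMk_right x)

lemma exists_abs_le (hT : BasicAssumption c T) : ∃ M : ℝ, ∀ p, |c p| ≤ M := by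
  obtain ⟨M, hM⟩ := hT.cost_bounded
  exact ⟨M, fun p => (abs_of_nonneg (hT.cost_nonneg p)).le.trans (hM p)⟩

lemma exists_cost_mem_Icc (hT : BasicAssumption c T) : ∃ M : ℝ, ∀ p, c p ∈ Set.Icc 0 M := by
  obtain ⟨M, hM⟩ := hT.cost_bounded
  exact ⟨M, fun p => ⟨hT.cost_nonneg p, hM p⟩⟩

end BasicAssumption

/-- The discounted Bellman equation has a bounded continuous solution. -/
lemma exists_bellman_fixedPoint [CompactSpace X] [OpensMeasurableSpace X] [Nonempty U]
    [IsMarkovKernel T] (hT : BasicAssumption c T) {β : ℝ} (hβ : 0 ≤ β) (hβ1 : β < 1) :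
    ∃ v : X →ᵇ ℝ, ∀ x, v x = ⨅ u, (c (x, u) + β * ∫ y, v y ∂(T (x, u))) := by
  have := hT.compact_action
  let Φ : (X →ᵇ ℝ) → (X →ᵇ ℝ) := fun v => BoundedContinuousFunction.mkOfCompact
    ⟨fun x => ⨅ u, (c (x, u) + β * ∫ y, v y ∂(T (x, u))), continuous_ciInf (hT.continuous_step β v)⟩
  -- Taking infima over `u` does not increase uniform distance, so the factor `β` in front of the
  -- integral is the contraction constant.
  have hΦ : ContractingWith ⟨β, hβ⟩ Φ := by
    refine ⟨hβ1, LipschitzWith.of_dist_le_mul fun v w => ?_⟩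
    refine (BoundedContinuousFunction.dist_le (by positivity)).2 fun x => ?_
    exact abs_ciInf_sub_ciInf_le (hT.continuous_step_right β v x) (hT.continuous_step_right β w x)
      fun u => abs_step_sub_step_le hβ v w (x, u)
  refine ⟨ContractingWith.fixedPoint Φ hΦ, fun x => ?_⟩
  exact (congrArg (fun v : X →ᵇ ℝ => v x) hΦ.fixedPoint_isFixedPt).symm

variable [BorelSpace X] [BorelSpace U] [SecondCountableTopology U]

/-- Normalized optimal discounted values lie between the bounds of the cost. -/
lemma normalized_discValue_mem_Icc [IsMarkovKernel T] (hT : BasicAssumption c T) {β M : ℝ}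
    (hβ : 0 ≤ β) (hβ1 : β < 1) (hM : ∀ p, c p ∈ Set.Icc 0 M) [Nonempty U] (x : X) :
    (1 - β) * discValue β c T x ∈ Set.Icc 0 M := by
  have hc := hT.cost_continuous.measurable
  have hM' : ∀ p, |c p| ≤ M := fun p => (abs_of_nonneg (hM p).1).le.trans (hM p).2
  have hM0 : 0 ≤ M := (hM (x, Classical.arbitrary U)).1.trans (hM (x, Classical.arbitrary U)).2
  have h1 : 0 < 1 - β := by linarith
  have hpos : ∀ γ : Policy X U, 0 ≤ discCost β c T γ x := fun γ =>
    le_discCost T (h := fun _ => 0) (B := 0) hc hM' measurable_const (by simp) hβ hβ1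
      (fun p => by simpa using (hM p).1) γ x
  let f : StationaryPolicy X U := ⟨fun _ => Classical.arbitrary U, measurable_const⟩
  -- The constant `M / (1 - β)` is the fixed point of `a ↦ M + β * a`, hence a supersolution for any
  -- policy.
  have hup : discCost β c T f.toPolicy x ≤ M / (1 - β) :=
    discCost_le T (h := fun _ => M / (1 - β)) (B := M / (1 - β)) hc hM' measurable_const
      (fun _ => (abs_of_nonneg (by positivity)).le) hβ hβ1 f
      (fun y => by
        have := (hM (y, f.1 y)).2
        simp only [integral_const, probReal_univ, one_smul]
        have h2 : M + β * (M / (1 - β)) = M / (1 - β) := by field_simp; ring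
        linarith) x
  have : Nonempty (Policy X U) := ⟨f.toPolicy⟩
  have hlow : 0 ≤ discValue β c T x := le_ciInf hpos
  have hv : discValue β c T x ≤ M / (1 - β) :=
    (ciInf_le ⟨0, Set.forall_mem_range.2 hpos⟩ f.toPolicy).trans hup
  refine ⟨by positivity, ?_⟩
  rw [le_div_iff₀ h1] at hv
  linarith

/-- A solution of the discounted Bellman equation is the optimal discounted value function. -/
lemma discValue_eq_of_bellman [Nonempty U] [IsMarkovKernel T] (hT : BasicAssumption c T) {β : ℝ}
    (hβ : 0 ≤ β) (hβ1 : β < 1) {v : X →ᵇ ℝ}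
    (hv : ∀ x, v x = ⨅ u, (c (x, u) + β * ∫ y, v y ∂(T (x, u)))) (x : X) :
    discValue β c T x = v x := by
  have := hT.compact_action
  obtain ⟨M, hM⟩ := hT.exists_abs_le
  have hc := hT.cost_continuous.measurable
  have hvm : Measurable v := v.continuous.measurable
  have hvB : ∀ y, |v y| ≤ ‖v‖ := v.norm_coe_le_norm
  have hle : ∀ γ : Policy X U, v x ≤ discCost β c T γ x := fun γ =>
    le_discCost T hc hM hvm hvB hβ hβ1 (fun p => by
      rw [hv p.1]
      exact ciInf_le_of_continuous (hT.continuous_step_right β v p.1) p.2) γ x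
  obtain ⟨f, hf, hfmin⟩ := exists_measurable_minimizer (hT.continuous_step β v)
  have hge := discCost_le T hc hM hvm hvB hβ hβ1 ⟨f, hf⟩
    (fun y => ((hfmin y).trans (hv y).symm).le) x
  have : Nonempty (Policy X U) := ⟨StationaryPolicy.toPolicy ⟨f, hf⟩⟩
  exact le_antisymm ((ciInf_le ⟨v x, Set.forall_mem_range.2 hle⟩ _).trans hge) (le_ciInf hle)

/-- The optimal discounted value function is bounded and continuous and solves the Bellman
equation. -/
lemma exists_discValue_eq [CompactSpace X] [Nonempty U] [IsMarkovKernel T]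
    (hT : BasicAssumption c T) {β : ℝ} (hβ : 0 ≤ β) (hβ1 : β < 1) :
    ∃ v : X →ᵇ ℝ, (∀ x, v x = ⨅ u, (c (x, u) + β * ∫ y, v y ∂(T (x, u)))) ∧
      ∀ x, discValue β c T x = v x := by
  obtain ⟨v, hv⟩ := exists_bellman_fixedPoint hT hβ hβ1
  exact ⟨v, hv, discValue_eq_of_bellman hT hβ hβ1 hv⟩

/-- The vanishing discount approach: uniformly Lipschitz optimal discounted values give a
canonical triplet. -/
lemma exists_vanishingDiscountTriplet [CompactSpace X] [Nonempty X] [Nonempty U]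
    [IsMarkovKernel T] (hT : BasicAssumption c T) {L : ℝ} (hL : LipschitzNearOne c T L) :
    ∃ g h γ, IsVanishingDiscountTriplet c T g h γ := by
  have := hT.compact_action
  obtain ⟨M, hM⟩ := hT.exists_cost_mem_Icc
  obtain ⟨b, hb, hb1, hLip⟩ := hL
  obtain ⟨β, hβ, hbβ⟩ := exists_increasesToOne hb hb1
  obtain ⟨z⟩ : Nonempty X := inferInstance
  choose v hv hdv using fun n => exists_discValue_eq hT (hβ.1 n).1.le (hβ.1 n).2
  obtain ⟨h, k, hk, hh⟩ := exists_subseq_tendsto_of_lipschitz (L := L) z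
    (fun n => v n - BoundedContinuousFunction.const X (v n z)) (by simp)
    (fun n x y => by simpa [hdv] using hLip (β n) (hbβ n) (hβ.1 n).2 x y)
  -- A further subsequence makes the normalized values at `z` converge as well.
  obtain ⟨g, -, l, hl, hg⟩ := isCompact_Icc.tendsto_subseq
    (x := fun n => (1 - β (k n)) * discValue (β (k n)) c T z)
    fun n => normalized_discValue_mem_Icc hT (hβ.1 (k n)).1.le (hβ.1 (k n)).2 hM z
  set β' := (β ∘ k) ∘ l with hβ'def
  have hβ' : IncreasesToOne β' := (hβ.comp_strictMono hk).comp_strictMono hl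
  set w : ℕ → X →ᵇ ℝ := fun n =>
    v (k (l n)) - BoundedContinuousFunction.const X (v (k (l n)) z) with hw
  have hwh : Tendsto w atTop (𝓝 h) := hh.comp hl.tendsto_atTop
  have hdisc : ∀ n x, discValue (β' n) c T x = v (k (l n)) x := fun n x => hdv _ x
  have hwx : ∀ x, Tendsto (fun n => w n x) atTop (𝓝 (h x)) := fun x =>
    tendsto_iff_dist_tendsto_zero.2 (squeeze_zero (fun _ => dist_nonneg)
      (fun _ => BoundedContinuousFunction.dist_coe_le_dist x)
      (tendsto_iff_dist_tendsto_zero.1 hwh))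
  have hgz : Tendsto (fun n => (1 - β' n) * discValue (β' n) c T z) atTop (𝓝 g) := hg
  have hβ0 : Tendsto (fun n => 1 - β' n) atTop (𝓝 0) := by
    simpa using hβ'.2.2.const_sub 1
  -- With `a` the value at `z` and `v = w + a`, the right side of the Bellman equation releases `β *
  -- a`, which leaves `(1 - β) * a` on the left.
  have hbell : ∀ n x, (1 - β' n) * discValue (β' n) c T z + w n x =
      ⨅ u, (c (x, u) + β' n * ∫ y, w n y ∂(T (x, u))) := by
    intro n x
    obtain ⟨a, ha⟩ : ∃ a, a = v (k (l n)) z := ⟨_, rfl⟩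
    have hint : ∀ u, c (x, u) + β' n * ∫ y, v (k (l n)) y ∂(T (x, u)) =
        (c (x, u) + β' n * ∫ y, w n y ∂(T (x, u))) + β' n * a := by
      intro u
      have : ∫ y, w n y ∂(T (x, u)) = ∫ y, v (k (l n)) y ∂(T (x, u)) - a := by
        simp only [hw, BoundedContinuousFunction.coe_sub, Pi.sub_apply,
          BoundedContinuousFunction.const_apply, ← ha]
        rw [integral_sub ((v _).integrable _) (integrable_const _)]
        simp
      rw [this]
      ring
    have h1 := hv (k (l n)) x
    change _ = ⨅ u, (c (x, u) + β' n * ∫ y, v (k (l n)) y ∂(T (x, u))) at h1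
    simp_rw [hint] at h1
    rw [← ciInf_add (isCompact_range (hT.continuous_step_right (β' n) (w n) x)).bddBelow] at h1
    rw [hdisc]
    simp only [hw, BoundedContinuousFunction.coe_sub, Pi.sub_apply,
      BoundedContinuousFunction.const_apply, ← ha] at h1 ⊢
    linarith
  have hcont1 := hT.continuous_step 1 h
  simp only [one_mul] at hcont1
  have hacoe : ∀ x, g + h x = ⨅ u, (c (x, u) + ∫ y, h y ∂(T (x, u))) := by
    intro x
    refine tendsto_nhds_unique (hgz.add (hwx x)) ?_
    simp_rw [hbell]
    -- The first error term comes from replacing `w n` by `h` under the factor `β' n`, the second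
    -- from replacing `β' n` by `1`.
    refine tendsto_iff_dist_tendsto_zero.2 (squeeze_zero (fun _ => dist_nonneg)
      (g := fun n => β' n * dist (w n) h + (1 - β' n) * ‖h‖) (fun n => ?_) ?_)
    · refine abs_ciInf_sub_ciInf_le (hT.continuous_step_right (β' n) (w n) x)
        (f' := fun u => c (x, u) + ∫ y, h y ∂(T (x, u)))
        (hcont1.comp (Continuous.prodMk_right x)) fun u => ?_
      have h1 := abs_step_sub_step_le (c := c) (T := T) (hβ'.1 n).1.le (w n) h (x, u)
      have h2 : |(1 - β' n) * ∫ y, h y ∂(T (x, u))| ≤ (1 - β' n) * ‖h‖ := by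
        have h0 : 0 ≤ 1 - β' n := by linarith [(hβ'.1 n).2]
        rw [abs_mul, abs_of_nonneg h0]
        gcongr
        exact abs_integral_le_of_forall_abs_le _ h.norm_coe_le_norm
      rw [abs_le] at h1 h2 ⊢
      constructor <;> linarith
    · have h1 := hβ'.2.2.mul (tendsto_iff_dist_tendsto_zero.1 hwh)
      simpa using h1.add (hβ0.mul_const ‖h‖)
  obtain ⟨f, hf, hfmin⟩ := exists_measurable_minimizer hcont1
  refine ⟨g, h, ⟨f, hf⟩, ⟨hacoe, fun x => (hacoe x).trans (hfmin x).symm⟩, z, β', hβ',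
    fun x => ⟨?_, ?_⟩⟩
  -- The normalized values at `x` and at `z` differ by `(1 - β' n) * w n x`, which tends to `0`, so
  -- the limit `g` does not depend on the state.
  · have h1 := hgz.add (hβ0.mul (hwx x))
    rw [zero_mul, add_zero] at h1
    refine h1.congr fun n => ?_
    rw [hdisc, hdisc]
    simp only [hw, BoundedContinuousFunction.coe_sub, Pi.sub_apply,
      BoundedContinuousFunction.const_apply]
    ring
  · simpa [hdisc, hw] using hwx x

end Bellman

/-! ### Comparison of the two models. -/

section Robustness

lemma le_supNorm {α : Type*} {f : α → ℝ} {B : ℝ} (hB : ∀ a, |f a| ≤ B) (a : α) :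
    |f a| ≤ supNorm f :=
  le_ciSup (f := fun a => |f a|) ⟨B, Set.forall_mem_range.2 hB⟩ a

lemma le_kernelDisc {X U : Type*} [MeasurableSpace X] [MeasurableSpace U]
    {T S : Kernel (X × U) X} [IsMarkovKernel T] [IsMarkovKernel S] {h : X → ℝ} {B : ℝ}
    (hB : ∀ y, |h y| ≤ B) (p : X × U) :
    |∫ y, h y ∂(T p) - ∫ y, h y ∂(S p)| ≤ kernelDisc h T S :=
  le_ciSup (f := fun p => |∫ y, h y ∂(T p) - ∫ y, h y ∂(S p)|)
    ⟨B + B, Set.forall_mem_range.2 fun _ => (abs_sub _ _).trans (add_le_add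
      (abs_integral_le_of_forall_abs_le _ hB) (abs_integral_le_of_forall_abs_le _ hB))⟩ p

/-- For an `L`-Lipschitz function the discrepancy is at most `L` times the uniform Wasserstein
distance. -/
lemma kernelDisc_le_mul_kernelW1 {X U : Type*} [MetricSpace X] [CompactSpace X]
    [MeasurableSpace X] [BorelSpace X] [Nonempty X] [MeasurableSpace U] [Nonempty U]
    {T S : Kernel (X × U) X} [IsMarkovKernel T] [IsMarkovKernel S] {h : X → ℝ} {L : ℝ}
    (hL : 0 < L) (hh : ∀ x y, |h x - h y| ≤ L * dist x y) :
    kernelDisc h T S ≤ L * kernelW1 T S := by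
  obtain ⟨z⟩ : Nonempty X := inferInstance
  set D := Metric.diam (Set.univ : Set X)
  -- An unbounded real supremum would default to `0`. Boundedness holds because adding a constant to
  -- `f` does not change the discrepancy of probability measures, and `f - f z` is bounded by the
  -- diameter.
  have hbdd : BddAbove (Set.range
      fun f : {f : X → ℝ // LipschitzWith 1 f} => kernelDisc f.1 T S) := by
    refine ⟨D + D, Set.forall_mem_range.2 fun ⟨f, hf⟩ => ciSup_le fun p => ?_⟩
    have hfz : ∀ y, |f y - f z| ≤ D := fun y => by
      have h1 := hf.dist_le_mul y z
      rw [NNReal.coe_one, one_mul, Real.dist_eq] at h1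
      exact h1.trans (Metric.dist_le_diam_of_mem isCompact_univ.isBounded (Set.mem_univ _)
        (Set.mem_univ _))
    have key : ∀ (μ : Measure X) [IsProbabilityMeasure μ],
        ∫ y, f y ∂μ = ∫ y, (f y - f z) ∂μ + f z := by
      intro μ _
      have hi : Integrable (fun y => f y - f z) μ :=
        integrable_of_abs_le μ (hf.continuous.sub continuous_const).measurable hfz
      have := integral_add hi (integrable_const (μ := μ) (f z))
      simpa using this
    rw [key, key (S p), add_sub_add_right_eq_sub]
    exact (abs_sub _ _).trans (add_le_add
      (abs_integral_le_of_forall_abs_le _ hfz) (abs_integral_le_of_forall_abs_le _ hfz))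
  have hlip : LipschitzWith 1 fun x => L⁻¹ * h x := by
    refine LipschitzWith.of_dist_le_mul fun x y => ?_
    rw [NNReal.coe_one, one_mul, Real.dist_eq, ← mul_sub, abs_mul, abs_of_pos (inv_pos.2 hL),
      inv_mul_le_iff₀ hL]
    exact hh x y
  have hle := le_ciSup hbdd ⟨_, hlip⟩
  have hlipB : ∀ y, |L⁻¹ * h y| ≤ D + |L⁻¹ * h z| := fun y => by
    have h1 := hlip.dist_le_mul y z
    rw [NNReal.coe_one, one_mul, Real.dist_eq] at h1
    have h2 : dist y z ≤ D := Metric.dist_le_diam_of_mem isCompact_univ.isBounded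
      (Set.mem_univ _) (Set.mem_univ _)
    linarith [abs_sub_abs_le_abs_sub (L⁻¹ * h y) (L⁻¹ * h z)]
  refine ciSup_le fun p => ?_
  have h1 := (le_kernelDisc (T := T) (S := S) hlipB p).trans hle
  rw [integral_const_mul, integral_const_mul, ← mul_sub, abs_mul, abs_of_pos (inv_pos.2 hL),
    inv_mul_le_iff₀ hL] at h1
  exact h1

/-- The relative value function of a vanishing discount triplet inherits the Lipschitz constant. -/
lemma IsVanishingDiscountTriplet.lipschitz {X U : Type*} [MetricSpace X]
    [MeasurableSpace X] [MeasurableSpace U] {c : X × U → ℝ} {T : Kernel (X × U) X}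
    [IsMarkovKernel T] {g : ℝ} {h : X →ᵇ ℝ} {γ : StationaryPolicy X U}
    (ht : IsVanishingDiscountTriplet c T g h γ) {L : ℝ} (hL : LipschitzNearOne c T L) (x y : X) :
    |h x - h y| ≤ L * dist x y := by
  obtain ⟨z, β, hβ, hlim⟩ := ht.limit
  obtain ⟨b, -, hb1, hb⟩ := hL
  refine le_of_tendsto (((hlim x).2.sub (hlim y).2).abs) ?_
  filter_upwards [hβ.2.2.eventually (eventually_ge_nhds hb1)] with n hn
  -- The values at the base state `z` cancel.
  rw [sub_sub_sub_cancel_right]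
  exact hb _ hn (hβ.1 n).2 x y

variable {X U : Type*} [MetricSpace X] [MeasurableSpace X] [BorelSpace X]
  [MetricSpace U] [MeasurableSpace U] [BorelSpace U]
  [SecondCountableTopology U] {c c' : X × U → ℝ} {T S : Kernel (X × U) X}
  [IsMarkovKernel T]

/-- The constant of a canonical triplet is a lower bound for the average cost of any policy. -/
lemma IsCanonicalTriplet.le_avgCost {g : ℝ} {h : X →ᵇ ℝ} {γ : StationaryPolicy X U}
    (ht : IsCanonicalTriplet c T g h γ) (hT : BasicAssumption c T) (π : Policy X U) (x : X) :
    g ≤ avgCost c T π x := by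
  have := hT.compact_action
  obtain ⟨M, hM⟩ := hT.exists_abs_le
  refine RobustMDP.le_avgCost T hT.cost_continuous.measurable hM h.continuous.measurable
    h.norm_coe_le_norm (fun p => ?_) π x
  rw [ht.acoe p.1]
  have hc := hT.continuous_step_right 1 h p.1
  simp only [one_mul] at hc
  exact ciInf_le_of_continuous hc p.2

/-- The average cost of the policy of a canonical triplet, applied to another MDP. -/
lemma IsCanonicalTriplet.avgCost_le {g : ℝ} {h : X →ᵇ ℝ} {γ : StationaryPolicy X U}
    (ht : IsCanonicalTriplet c' S g h γ) (hT : BasicAssumption c T) {δ ε : ℝ}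
    (hδ : ∀ p, |c p - c' p| ≤ δ) (hε : ∀ p, |∫ y, h y ∂(T p) - ∫ y, h y ∂(S p)| ≤ ε) (x : X) :
    avgCost c T γ.toPolicy x ≤ g + δ + ε := by
  obtain ⟨M, hM⟩ := hT.exists_abs_le
  refine RobustMDP.avgCost_le T hT.cost_continuous.measurable hM h.continuous.measurable
    h.norm_coe_le_norm γ (fun y => ?_) x
  linarith [ht.attained y, (abs_le.1 (hδ (y, γ.1 y))).2, (abs_le.1 (hε (y, γ.1 y))).2]

/-- The upper bound is the comparison of the model with itself, at zero error. -/
lemma IsCanonicalTriplet.avgValue_eq {g : ℝ} {h : X →ᵇ ℝ} {γ : StationaryPolicy X U}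
    (ht : IsCanonicalTriplet c T g h γ) (hT : BasicAssumption c T) (x : X) :
    avgValue c T x = g := by
  have hle := fun π => ht.le_avgCost hT π x
  have hge := ht.avgCost_le hT (δ := 0) (ε := 0) (by simp) (by simp) x
  have : Nonempty (Policy X U) := ⟨γ.toPolicy⟩
  refine le_antisymm ((ciInf_le ⟨g, Set.forall_mem_range.2 hle⟩ γ.toPolicy).trans ?_) (le_ciInf hle)
  linarith

/-- Performance loss of a policy that is optimal for an approximate model. -/
lemma supNorm_avgCost_sub_avgValue_le [IsMarkovKernel S] [Nonempty X] (hT : BasicAssumption c T)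
    (hS : BasicAssumption c' S) {gT gS : ℝ} {hrT hrS : X →ᵇ ℝ} {γT γS : StationaryPolicy X U}
    (htT : IsCanonicalTriplet c T gT hrT γT) (htS : IsCanonicalTriplet c' S gS hrS γS) :
    supNorm (fun x => avgCost c T γS.toPolicy x - avgValue c T x) ≤
      2 * supNorm (fun p => c p - c' p) + (kernelDisc hrT T S + kernelDisc hrS T S) := by
  obtain ⟨M, hM⟩ := hT.exists_abs_le
  obtain ⟨M', hM'⟩ := hS.exists_abs_le
  have hδ : ∀ p, |c p - c' p| ≤ supNorm fun p => c p - c' p :=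
    le_supNorm (B := M + M') fun p => (abs_sub _ _).trans (add_le_add (hM p) (hM' p))
  refine ciSup_le fun x => ?_
  -- `h1` bounds the cost of `γS` through `gS`; `h2` and `h3` bound `gS` through `gT` by running
  -- `γT` in the approximate model; `h4` fixes the sign inside the absolute value.
  have h1 := htS.avgCost_le hT hδ (le_kernelDisc hrS.norm_coe_le_norm) x
  have h2 := htT.avgCost_le hS (fun p => (abs_sub_comm _ _).trans_le (hδ p))
    (fun p => (abs_sub_comm _ _).trans_le (le_kernelDisc (T := T) hrT.norm_coe_le_norm p)) x
  have h3 := htS.le_avgCost hS γT.toPolicy x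
  have h4 := htT.le_avgCost hT γS.toPolicy x
  change |avgCost c T γS.toPolicy x - avgValue c T x| ≤ _
  rw [htT.avgValue_eq hT, abs_of_nonneg (by linarith)]
  linarith

end Robustness

end RobustMDP

theorem mainTheorem5 {X U : Type*}
    [MetricSpace X] [CompleteSpace X] [SecondCountableTopology X]
    [MeasurableSpace X] [BorelSpace X] [Nonempty X]
    [MetricSpace U] [CompleteSpace U] [SecondCountableTopology U]
    [MeasurableSpace U] [BorelSpace U] [Nonempty U]
    (T S : Kernel (X × U) X) [IsMarkovKernel T] [IsMarkovKernel S]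
    (c c' : X × U → ℝ) (L : ℝ) (hL : 0 < L)
    (hT : RobustMDP.BasicAssumption c T) (hS : RobustMDP.BasicAssumption c' S)
    (hX : CompactSpace X)
    (hTL : RobustMDP.LipschitzNearOne c T L) (hSL : RobustMDP.LipschitzNearOne c' S L) :
    (∃ g h γ, RobustMDP.IsVanishingDiscountTriplet c T g h γ) ∧
    (∃ g h γ, RobustMDP.IsVanishingDiscountTriplet c' S g h γ) ∧
    ∀ (gS : ℝ) (hrelS : X →ᵇ ℝ) (γS : RobustMDP.StationaryPolicy X U),
      RobustMDP.IsVanishingDiscountTriplet c' S gS hrelS γS →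
      RobustMDP.VanishingDiscountCondition c T γS.toPolicy →
      RobustMDP.supNorm
          (fun x => RobustMDP.avgCost c T γS.toPolicy x - RobustMDP.avgValue c T x)
        ≤ 2 * RobustMDP.supNorm (fun p => c p - c' p) + 2 * L * RobustMDP.kernelW1 T S ∧
      ∀ L' : ℝ, 0 < L' → RobustMDP.JointlyW1Lipschitz T L' → RobustMDP.JointlyW1Lipschitz S L' →
        ∀ (gT : ℝ) (hrelT : X →ᵇ ℝ) (γT : RobustMDP.StationaryPolicy X U),
          RobustMDP.IsVanishingDiscountTriplet c T gT hrelT γT →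
          RobustMDP.supNorm
              (fun x => RobustMDP.avgCost c T γS.toPolicy x - RobustMDP.avgValue c T x)
            ≤ 2 * RobustMDP.supNorm (fun p => c p - c' p)
              + (RobustMDP.kernelDisc hrelT T S + RobustMDP.kernelDisc hrelS T S) := by
  have hTex := RobustMDP.exists_vanishingDiscountTriplet hT hTL
  refine ⟨hTex, RobustMDP.exists_vanishingDiscountTriplet hS hSL,
    fun gS hrelS γS htS _ => ⟨?_, fun _ _ _ _ gT hrelT γT htT =>
      RobustMDP.supNorm_avgCost_sub_avgValue_le hT hS htT.canonical htS.canonical⟩⟩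
  -- The first bound mentions no triplet of the reference model, so one is taken from the existence
  -- part.
  obtain ⟨g, h, γ, ht⟩ := hTex
  have h0 := RobustMDP.supNorm_avgCost_sub_avgValue_le hT hS ht.canonical htS.canonical
  have h1 := RobustMDP.kernelDisc_le_mul_kernelW1 (T := T) (S := S) hL (ht.lipschitz hTL)
  have h2 := RobustMDP.kernelDisc_le_mul_kernelW1 (T := T) (S := S) hL (htS.lipschitz hSL)
  linarith
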